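/- Let $R$ be a commutative noetherian integral domain in which $2$ is invertible, with field of fractions $K$. Let $A$ be a commutative Hopf algebra over $R$, finite and flat as an $R$-module, with comultiplication $\Delta$ and counit $\varepsilon$, and let $A^D=\mathrm{Hom}_R(A,R)$ be the dual algebra, with product $(fg)(a)=\sum f(a_{(1)})g(a_{(2)})$. For an $R$-module $M$ put $M_K=K\otimes_R M$; $(A^D)_K$ is identified with $(A_K)^D=\mathrm{Hom}_K(A_K,K)$. If $M$ is a right $A$-comodule with coaction $m\mapsto\sum m_{(0)}\otimes m_{(1)}$, then $A^D$ acts on $M$ by $gm=\sum\langle g,m_{(1)}\rangle m_{(0)}$, and likewise $A^D_K$ acts on $M_K$; in particular $A^D_K$ acts on $A_K$ through $\Delta$. Let $$I(A)=\{x\in A\mid ax=\varepsilon(a)x\ \ \forall a\in A\},\qquad I(A^D)=\{f\in A^D\mid uf=u(1)f\ \ \forall u\in A^D\}$$ be the modules of left integrals, and define $I(A_K)$ in the same way over $K$. A principal homogeneous space for $A$ over $R$ is a commutative $R$-algebra $B$, finite and flat as an $R$-module, with a coassociative and counital homomorphism of $R$-algebras $\alpha_B\colon B\to B\otimes_R A$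 such that the structure map $R\to B$ is injective with image $\{b\in B\mid\alpha_B(b)=b\otimes 1\}$, and such that $B\otimes_R B\to B\otimes_R A$, $b\otimes b'\mapsto (b\otimes 1)\alpha_B(b')$, is an isomorphism. Let $\mathrm{Tr}$ be the trace of the $K$-algebra $B_K$, and let $\mathcal D^{-1}(B)=\{x\in B_K\mid \mathrm{Tr}(xb)\in R\ \ \forall b\in B\}$ be the codifferent of $B$. Assume that $I(A)$ is a free $R$-module and that $A_K$ is a separable $K$-algebra. Then there are a unique idempotent $e\in A_K$ with $I(A_K)=Ke$, a unique fractional ideal $\Lambda$ of $R$ with $I(A)=\Lambda e$, and a unique $t\in A^D_K$ with $te=1_{A_K}$, and the following hold, where $\Lambda^{-1}=\{c\in K\mid c\Lambda\subseteq R\}$. (i) $I(A^D)=\Lambda^{-1}t$ inside $A^D_K$. (ii) For every principal homogeneous space $B$ for $A$ over $R$, $\mathrm{Tr}(x)=tx$ for all $x\in B_K$. (iii) For every principal homogeneous space $B$ for $A$ over $R$, $\mathcal D^{-1}(B)=\Lambda^{-1}B$. -/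

import Mathlib

open scoped TensorProduct nonZeroDivisors

noncomputable section

namespace HopfPHS

section Basic

variable (R : Type*) [CommRing R]

/-- The dual algebra `A^D = Hom_R(A, R)` with the convolution product
`(f * g)(a) = ∑ f(a₍₁₎) g(a₍₂₎)`, whose unit is the counit of `A`. -/
abbrev DualAlg (A : Type*) [AddCommGroup A] [Module R A] [Coalgebra R A] : Type _ :=
  WithConv (A →ₗ[R] R)

/-- The module of left integrals `I(A) = {x ∈ A | a x = ε(a) x for all a ∈ A}`. -/
def leftIntegrals (A : Type*) [Ring A] [HopfAlgebra R A] : Submodule R A where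
  carrier := {x | ∀ a : A, a * x = Coalgebra.counit (R := R) a • x}
  add_mem' := by
    intro x y hx hy a
    rw [mul_add, hx a, hy a, smul_add]
  zero_mem' := by intro a; simp
  smul_mem' := by
    intro r x hx a
    rw [mul_smul_comm, hx a, smul_comm]

/-- The module of left integrals of the dual algebra,
`I(A^D) = {f ∈ A^D | u f = ε^D(u) f for all u ∈ A^D}`, where `ε^D(u) = u(1)`. -/
def dualLeftIntegrals (A : Type*) [Ring A] [HopfAlgebra R A] :
    Submodule R (DualAlg R A) where
  carrier := {f | ∀ u : DualAlg R A, u * f = u.ofConv 1 • f}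
  add_mem' := by
    intro x y hx hy a
    rw [mul_add, hx a, hy a, smul_add]
  zero_mem' := by intro a; simp
  smul_mem' := by
    intro r x hx a
    rw [mul_smul_comm, hx a, smul_comm]

variable {R}

/-- The action of `g ∈ C^D` on a right `C`-comodule `(M, ρ)`:
`g m = ∑ ⟨g, m₍₁₎⟩ m₍₀₎`. -/
def dualAct {M C : Type*} [AddCommGroup M] [Module R M]
    [AddCommGroup C] [Module R C] [Coalgebra R C]
    (ρ : M →ₗ[R] M ⊗[R] C) (g : DualAlg R C) : M →ₗ[R] M :=
  (TensorProduct.rid R M).toLinearMap ∘ₗ LinearMap.lTensor M g.ofConv ∘ₗ ρ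

/-- `α : B → B ⊗ A` makes the commutative `R`-algebra `B` a principal homogeneous space for the
commutative Hopf algebra `A` over `R`. -/
structure IsPHS {A B : Type*} [CommRing A] [HopfAlgebra R A] [CommRing B] [Algebra R B]
    (α : B →ₐ[R] B ⊗[R] A) : Prop where
  finite : Module.Finite R B
  flat : Module.Flat R B
  /-- coassociativity of the coaction -/
  coassoc : ∀ b : B, TensorProduct.assoc R B A A (LinearMap.rTensor A α.toLinearMap (α b)) =
    LinearMap.lTensor B Coalgebra.comul (α b)
  /-- counitality of the coaction -/
  counit : ∀ b : B, TensorProduct.rid R B (LinearMap.lTensor B Coalgebra.counit (α b)) = b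
  /-- `B^A = R`: the structure map identifies `R` with the subring of coinvariants. -/
  injective : Function.Injective (algebraMap R B)
  coinvariants : ∀ b : B, α b = b ⊗ₜ[R] (1 : A) ↔ b ∈ Set.range (algebraMap R B)
  /-- The homomorphism of `B`-algebras `B ⊗ B → B ⊗ A`, `b ⊗ b' ↦ (b ⊗ 1) α(b')`, is an
  isomorphism. (By coassociativity it is automatically linear over `A^D`, which acts on the
  second factors.) -/
  bijective : Function.Bijective
    (Algebra.TensorProduct.lift
      (Algebra.TensorProduct.includeLeft : B →ₐ[B] B ⊗[R] A) α (fun _ _ => Commute.all _ _))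

end Basic

section Generic

variable {R : Type*} [CommRing R] (K : Type*) [Field K] [Algebra R K]

/-- The canonical map `M → M_K = K ⊗ M`, `m ↦ 1 ⊗ m`. -/
def toGeneric (M : Type*) [AddCommGroup M] [Module R M] : M →ₗ[R] K ⊗[R] M :=
  TensorProduct.mk R K M 1

/-- The canonical map `A^D → (A_K)^D`: the `K`-linear extension of functionals. -/
def dualToGeneric (A : Type*) [Ring A] [HopfAlgebra R A] :
    DualAlg R A →ₗ[R] DualAlg K (K ⊗[R] A) where
  toFun f := WithConv.toConv (LinearMap.liftBaseChange K (Algebra.linearMap R K ∘ₗ f.ofConv))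
  map_add' f g := by
    apply WithConv.ofConv_injective
    ext a
    simp
  map_smul' r f := by
    apply WithConv.ofConv_injective
    ext a
    simp [Algebra.smul_def]

/-- The coaction `B_K → B_K ⊗_K A_K` obtained from `α : B → B ⊗_R A` by extension of scalars. -/
def genericCoaction {A B : Type*} [CommRing A] [Algebra R A] [CommRing B] [Algebra R B]
    (α : B →ₐ[R] B ⊗[R] A) :
    K ⊗[R] B →ₗ[K] (K ⊗[R] B) ⊗[K] (K ⊗[R] A) :=
  (TensorProduct.AlgebraTensorModule.distribBaseChange R K B A).toLinearMap ∘ₗ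
    α.toLinearMap.baseChange K

instance (A : Type*) [Ring A] [HopfAlgebra R A] : IsScalarTower R K (DualAlg K (K ⊗[R] A)) where
  smul_assoc r c f := by
    apply WithConv.ofConv_injective
    ext a
    simp

variable {K}

/-- `J v = {c v | c ∈ J}` for a fractional ideal `J` and a vector `v` of a `K`-vector space. -/
def fracSMul {V : Type*} [AddCommGroup V] [Module R V] [Module K V] [IsScalarTower R K V]
    (J : FractionalIdeal R⁰ K) (v : V) : Submodule R V :=
  (J : Submodule R K).map ((LinearMap.toSpanSingleton K V v).restrictScalars R)

/-- `J B ⊆ B_K`: the `R`-module generated by the elements `c b`, with `c ∈ J` and `b ∈ B`. -/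
def fracMul (J : FractionalIdeal R⁰ K) (B : Type*) [CommRing B] [Algebra R B] :
    Submodule R (K ⊗[R] B) :=
  Submodule.span R {x | ∃ c ∈ J, ∃ b : B, x = c • toGeneric K B b}

variable (R K)

/-- The codifferent `{x ∈ B_K | Tr(x b) ∈ R for all b ∈ B}`. -/
def codifferent (B : Type*) [CommRing B] [Algebra R B] : Submodule R (K ⊗[R] B) :=
  (Algebra.traceForm K (K ⊗[R] B)).dualSubmodule (LinearMap.range (toGeneric (R := R) K B))

end Generic

end HopfPHS

end

/-! Everything reduces to one functional, `t = Tr`, the trace of `A_K`. Since `A_K` is reduced, its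
augmentation ideal is generated by an idempotent `f`, and `e = 1 - f` has `ε(e) = 1` and spans the
integrals. Multiplication by `e` is the rank-one map `a ↦ ε(a) e`, so `Tr(e) = 1`. The Galois map `B
⊗ B → B ⊗ A` is an isomorphism of `B`-algebras, so it preserves traces over `B`; evaluated at `1 ⊗
b` over `K`, this says that `Tr` of `A_K` acts on `B_K` as the trace of `B_K`. This is (ii), and for
`B = A` it gives `Tr · e = Tr(e) 1 = 1`. Uniqueness of `t` holds because `f ↦ f e` is onto, hence
injective by dimension. Freeness gives `I(A) = R x`, and `x = l e` with `l = ε(x)`, so `Λ = l R`. A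
partial trace of `Δ` shows that `Tr(a)` is the counit of an integral for every `a ∈ A`
(`trace_one_tmul_mem`), so `l⁻¹ Tr` is integral on `A`. It generates `I(A^D)`, because `f x = f(x)
1` determines an integral `f`. For (iii), `l⁻¹ Tr` maps `B` into its coinvariants, that is into `R`,
so `l⁻¹ B` lies in the codifferent; conversely the preimage `q` of `1 ⊗ x` under the Galois map
satisfies `(id ⊗ Tr)(q (1 ⊗ z)) = l z`, which lies in `B` for `z` in the codifferent. -/

noncomputable section

namespace HopfPHS

/-! ### Contraction against functionals -/

section Slice

variable {R : Type*} [CommRing R]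

/-- Contraction of the second tensor factor against a functional. -/
def slice {M C : Type*} [AddCommGroup M] [Module R M] [AddCommGroup C] [Module R C]
    (f : C →ₗ[R] R) : M ⊗[R] C →ₗ[R] M :=
  (TensorProduct.rid R M).toLinearMap ∘ₗ LinearMap.lTensor M f

@[simp]
lemma slice_tmul {M C : Type*} [AddCommGroup M] [Module R M] [AddCommGroup C] [Module R C]
    (f : C →ₗ[R] R) (m : M) (c : C) : slice f (m ⊗ₜ[R] c) = f c • m := by
  simp [slice]

lemma slice_smul {M C : Type*} [AddCommGroup M] [Module R M] [AddCommGroup C] [Module R C]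
    (c : R) (f : C →ₗ[R] R) (z : M ⊗[R] C) : slice (c • f) z = c • slice f z := by
  simp [slice, LinearMap.lTensor_smul]

lemma dualAct_apply {M C : Type*} [AddCommGroup M] [Module R M]
    [AddCommGroup C] [Module R C] [Coalgebra R C]
    (ρ : M →ₗ[R] M ⊗[R] C) (g : DualAlg R C) (m : M) :
    dualAct ρ g m = slice g.ofConv (ρ m) := rfl

lemma slice_tmul_one_mul {B C : Type*} [CommRing B] [Algebra R B] [CommRing C] [Algebra R C]
    (f : C →ₗ[R] R) (b : B) (z : B ⊗[R] C) :
    slice f ((b ⊗ₜ[R] (1 : C)) * z) = b * slice f z := by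
  induction z with
  | zero => simp
  | add z w hz hw => simp [mul_add, hz, hw]
  | tmul c d => simp

lemma slice_one_tmul_mul {B C : Type*} [CommRing B] [Algebra R B] [CommRing C] [Algebra R C]
    (f : C →ₗ[R] R) (c : C) (z : B ⊗[R] C) :
    slice f (((1 : B) ⊗ₜ[R] c) * z) = slice (f ∘ₗ LinearMap.mulLeft R c) z := by
  induction z with
  | zero => simp
  | add z w hz hw => simp [mul_add, hz, hw]
  | tmul c d => simp

end Slice

/-! ### Antipode identities and integrals -/

section Hopf

variable {R : Type*} [CommRing R] {A : Type*} [CommRing A] [HopfAlgebra R A]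

open Coalgebra HopfAlgebra

/-- By coassociativity the sum is `∑ c₍₁₎ ⊗ c₍₂₎ S(c₍₃₎)`, and the antipode axiom collapses the
second factor. -/
lemma sum_one_tmul_antipode_mul_comul (c : A) :
    ∑ i ∈ (ℛ R c).index, ((1 : A) ⊗ₜ[R] antipode R ((ℛ R c).right i)) *
      comul (R := R) ((ℛ R c).left i) = c ⊗ₜ[R] 1 := by
  let F : (A ⊗[R] A) ⊗[R] A →ₗ[R] A ⊗[R] A :=
    LinearMap.lTensor A (LinearMap.mul' R A ∘ₗ LinearMap.lTensor A (antipode R)) ∘ₗ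
      (TensorProduct.assoc R A A A).toLinearMap
  have hF : ∀ (z : A ⊗[R] A) (a : A),
      F (z ⊗ₜ[R] a) = ((1 : A) ⊗ₜ[R] antipode R a) * z := by
    intro z a
    induction z with
    | zero => simp
    | add z w hz hw => simp only [TensorProduct.add_tmul, map_add, hz, hw, mul_add]
    | tmul u v => simp [F, mul_comm]
  have h1 := congrArg (LinearMap.lTensor A (LinearMap.mul' R A ∘ₗ LinearMap.lTensor A (antipode R)))
    (coassoc_apply (R := R) c)
  conv_lhs at h1 => rw [← (ℛ R c).eq]
  simp only [map_sum, LinearMap.rTensor_tmul] at h1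
  simp_rw [← hF]
  refine h1.trans ?_
  have h2 := congrArg (LinearMap.lTensor A (Algebra.linearMap R A)) (lTensor_counit_comul (R := R) c)
  rw [← LinearMap.lTensor_comp_apply] at h2 ⊢
  rw [LinearMap.comp_assoc, mul_antipode_lTensor_comul, h2]
  simp

lemma sum_antipode_tmul_one_mul_comul (c : A) :
    ∑ i ∈ (ℛ R c).index, (antipode R ((ℛ R c).left i) ⊗ₜ[R] (1 : A)) *
      comul (R := R) ((ℛ R c).right i) = 1 ⊗ₜ[R] c := by
  let F : A ⊗[R] (A ⊗[R] A) →ₗ[R] A ⊗[R] A :=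
    LinearMap.rTensor A (LinearMap.mul' R A ∘ₗ LinearMap.rTensor A (antipode R)) ∘ₗ
      (TensorProduct.assoc R A A A).symm.toLinearMap
  have hF : ∀ (z : A ⊗[R] A) (a : A),
      F (a ⊗ₜ[R] z) = (antipode R a ⊗ₜ[R] (1 : A)) * z := by
    intro z a
    induction z with
    | zero => simp
    | add z w hz hw => simp only [TensorProduct.tmul_add, map_add, hz, hw, mul_add]
    | tmul u v => simp [F]
  have h1 := congrArg (LinearMap.rTensor A (LinearMap.mul' R A ∘ₗ LinearMap.rTensor A (antipode R)))
    (coassoc_symm_apply (R := R) c)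
  conv_lhs at h1 => rw [← (ℛ R c).eq]
  simp only [map_sum, LinearMap.lTensor_tmul] at h1
  simp_rw [← hF]
  refine h1.trans ?_
  have h2 := congrArg (LinearMap.rTensor A (Algebra.linearMap R A)) (rTensor_counit_comul (R := R) c)
  rw [← LinearMap.rTensor_comp_apply] at h2 ⊢
  rw [LinearMap.comp_assoc, mul_antipode_rTensor_comul, h2]
  simp

/-- Substitute `c ⊗ 1 = ∑ (1 ⊗ S(c₍₂₎)) Δ(c₍₁₎)`; then `Δ(c₍₁₎) Δ(x) = ε(c₍₁₎) Δ(x)`, and the counit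
axiom leaves `1 ⊗ S(c)`. -/
lemma comul_integral_mul {x : A} (hx : x ∈ leftIntegrals R A) (c : A) :
    (c ⊗ₜ[R] (1 : A)) * comul (R := R) x = (1 ⊗ₜ[R] antipode R c) * comul (R := R) x := by
  have hx' : ∀ a : A, a * x = counit (R := R) a • x := hx
  rw [← sum_one_tmul_antipode_mul_comul (R := R) c, Finset.sum_mul]
  simp_rw [mul_assoc, ← Bialgebra.comul_mul, hx', map_smul, mul_smul_comm, ← smul_mul_assoc]
  rw [← Finset.sum_mul]
  congr 1
  have := sum_counit_smul (ℛ R c)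
  conv_rhs => rw [← this]
  simp [TensorProduct.tmul_sum]

/-- The partial trace of `b ↦ Δ(b a)` is a left integral. -/
lemma sum_slice_comul_mem {n : ℕ} (b : Fin n → A) (φ : Fin n → A →ₗ[R] R)
    (hb : ∀ a, ∑ i, φ i a • b i = a) (a : A) :
    ∑ i, slice (φ i) (comul (R := R) (b i * a)) ∈ leftIntegrals R A := by
  -- Cyclicity of the partial trace: multiplying by `c` after `b ↦ Δ(b a)` or before it gives the
  -- same result.
  have cyc : ∀ c a : A, ∑ i, slice (φ i) ((1 ⊗ₜ[R] c) * comul (R := R) (b i * a)) =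
      ∑ i, slice (φ i) (comul (R := R) (b i * (c * a))) := by
    intro c a
    have hφ : ∀ i, φ i ∘ₗ LinearMap.mulLeft R c = ∑ j, φ i (c * b j) • φ j := by
      intro i
      ext d
      conv_lhs => rw [← hb d]
      simp [mul_comm]
    have h1 : ∀ (f : Fin n → R) (z : A ⊗[R] A),
        slice (∑ j, f j • φ j) z = ∑ j, f j • slice (φ j) z := by
      intro f z
      induction z with
      | zero => simp
      | add z w hz hw => simp [hz, hw, Finset.sum_add_distrib]
      | tmul u v => simp [Finset.sum_smul, smul_smul]
    simp_rw [slice_one_tmul_mul, hφ, h1]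
    rw [Finset.sum_comm]
    refine Finset.sum_congr rfl fun j _ => ?_
    rw [show b j * (c * a) = (c * b j) * a by ring]
    conv_rhs => rw [← hb (c * b j)]
    simp only [Finset.sum_mul, map_sum, smul_mul_assoc, map_smul]
  intro c
  rw [Finset.mul_sum]
  simp_rw [← slice_tmul_one_mul]
  -- After this expansion of `c ⊗ 1`, `cyc` moves `S(c₍₂₎)` next to `c₍₁₎`, where the two combine to
  -- `ε(c)`.
  rw [← sum_one_tmul_antipode_mul_comul (R := R) c]
  simp_rw [Finset.sum_mul, mul_assoc, ← Bialgebra.comul_mul, map_sum]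
  rw [Finset.sum_comm]
  simp_rw [show ∀ i j, (ℛ R c).left j * (b i * a) = b i * ((ℛ R c).left j * a) from
    fun _ _ => by ring, cyc, Finset.smul_sum]
  rw [Finset.sum_comm]
  refine Finset.sum_congr rfl fun i _ => ?_
  simp_rw [← map_sum, ← Finset.mul_sum, ← map_smul]
  congr 2
  simp_rw [← mul_assoc, ← Finset.sum_mul, mul_comm (antipode R _)]
  rw [sum_mul_antipode_eq_smul]
  simp

end Hopf

/-! ### Traces, integrals and Galois maps over a field -/

section Field

open Coalgebra HopfAlgebra

variable {k : Type*} [Field k]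

lemma slice_trace {L C : Type*} [CommRing L] [Algebra k L] [CommRing C] [Algebra k C]
    [Module.Finite k C] (z : L ⊗[k] C) :
    slice (Algebra.trace k C) z = Algebra.trace L (L ⊗[k] C) z := by
  induction z with
  | zero => simp
  | add z w hz hw => simp [hz, hw]
  | tmul l c =>
    have : l ⊗ₜ[k] c = l • ((1 : L) ⊗ₜ[k] c) := by simp [TensorProduct.smul_tmul']
    have h2 : LinearMap.mulLeft L ((1 : L) ⊗ₜ[k] c) = (LinearMap.mulLeft k c).baseChange L := by
      ext; simp
    rw [slice_tmul, this, map_smul, Algebra.trace_apply L]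
    change _ = l • LinearMap.trace L _ (LinearMap.mulLeft L ((1 : L) ⊗ₜ[k] c))
    rw [h2, LinearMap.trace_baseChange, Algebra.smul_def, smul_eq_mul, mul_comm]
    rfl

/-- The Galois map `b ⊗ b' ↦ (b ⊗ 1) α(b')`. -/
abbrev galoisMap {R : Type*} [CommRing R] {A B : Type*} [CommRing A] [Algebra R A] [CommRing B]
    [Algebra R B] (α : B →ₐ[R] B ⊗[R] A) : B ⊗[R] B →ₐ[B] B ⊗[R] A :=
  Algebra.TensorProduct.lift
    (Algebra.TensorProduct.includeLeft : B →ₐ[B] B ⊗[R] A) α (fun _ _ => Commute.all _ _)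

/-- Both sides are traces over `B`, and the Galois map is an isomorphism of `B`-algebras. -/
lemma slice_trace_galoisMap {A B : Type*} [CommRing A] [Algebra k A] [Module.Finite k A]
    [CommRing B] [Algebra k B] [Module.Finite k B] {α : B →ₐ[k] B ⊗[k] A}
    (h : Function.Bijective (galoisMap α)) (z : B ⊗[k] B) :
    slice (Algebra.trace k A) (galoisMap α z) = slice (Algebra.trace k B) z := by
  rw [slice_trace, slice_trace]
  exact Algebra.trace_eq_of_algEquiv (AlgEquiv.ofBijective _ h) z

lemma slice_trace_coaction {A B : Type*} [CommRing A] [Algebra k A] [Module.Finite k A]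
    [CommRing B] [Algebra k B] [Module.Finite k B] {α : B →ₐ[k] B ⊗[k] A}
    (h : Function.Bijective (galoisMap α)) (x : B) :
    slice (Algebra.trace k A) (α x) = algebraMap k B (Algebra.trace k B x) := by
  have := slice_trace_galoisMap h (1 ⊗ₜ x)
  rw [slice_tmul, Algebra.TensorProduct.lift_tmul, map_one, one_mul] at this
  rw [this, Algebra.algebraMap_eq_smul_one]

lemma isReduced_of_isSeparable {C : Type*} [CommRing C] [Algebra k C]
    (h : Algebra.IsSeparable k C) : IsReduced C := by
  refine ⟨fun x ⟨n, hn⟩ => ?_⟩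
  have hd : minpoly k x ∣ Polynomial.X ^ n := minpoly.dvd k x (by simp [hn])
  have h1 : minpoly k x ∣ Polynomial.X :=
    (Algebra.IsSeparable.isSeparable k x).squarefree.isRadical n _ hd
  simpa using Polynomial.aeval_eq_zero_of_dvd_aeval_eq_zero h1 (minpoly.aeval k x)

variable {A : Type*} [CommRing A] [HopfAlgebra k A] [Module.Finite k A]

variable (k A) in
-- A reduced Artinian ring is semisimple, so the augmentation ideal is generated by an idempotent
-- `f`. Each `a - ε(a)` is a multiple of `f`, hence is killed by `1 - f`.
lemma exists_idempotent_integral [IsReduced A] :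
    ∃ e : A, IsIdempotentElem e ∧ counit (R := k) e = 1 ∧ leftIntegrals k A = Submodule.span k {e} := by
  have : IsArtinianRing A := IsArtinianRing.of_finite k A
  have : IsSemisimpleRing A := IsArtinianRing.isSemisimpleRing_of_isReduced A
  obtain ⟨f, hf, hI⟩ := IsSemisimpleRing.ideal_eq_span_idempotent
    (RingHom.ker (Bialgebra.counitAlgHom k A))
  have hf0 : counit (R := k) f = 0 := by
    have : f ∈ RingHom.ker (Bialgebra.counitAlgHom k A) := hI ▸ Ideal.mem_span_singleton_self f
    exact this
  have key : ∀ a : A, a * (1 - f) = counit (R := k) a • (1 - f) := by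
    intro a
    have : a - algebraMap k A (counit (R := k) a) ∈ RingHom.ker (Bialgebra.counitAlgHom k A) := by
      rw [RingHom.mem_ker, map_sub, AlgHom.commutes]
      simp
    rw [hI, Ideal.mem_span_singleton'] at this
    obtain ⟨c, hc⟩ := this
    rw [Algebra.smul_def, ← sub_eq_zero, ← sub_mul, ← hc, mul_assoc, mul_sub, hf.eq]
    simp
  refine ⟨1 - f, hf.one_sub, by simp [hf0], le_antisymm (fun x hx => ?_) ?_⟩
  · have h1 : f * x = 0 := by rw [hx f, hf0, zero_smul]
    rw [Submodule.mem_span_singleton]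
    exact ⟨counit (R := k) x, by rw [← key, mul_sub, mul_comm x f, h1, mul_one, sub_zero]⟩
  · rw [Submodule.span_singleton_le_iff_mem]
    exact key

omit [Module.Finite k A] in
lemma mul_generator {e : A} (hI : leftIntegrals k A = Submodule.span k {e}) (a : A) :
    a * e = counit (R := k) a • e := by
  have : e ∈ leftIntegrals k A := hI ▸ Submodule.mem_span_singleton_self e
  exact this a

/-- The space of integrals is nonzero, so `e ≠ 0`; compare `e = e²` with `e² = ε(e) e`. -/
lemma counit_generator [IsReduced A] {e : A} (he : IsIdempotentElem e)
    (hI : leftIntegrals k A = Submodule.span k {e}) : counit (R := k) e = 1 := by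
  have hne : e ≠ 0 := by
    rintro rfl
    obtain ⟨e', he', h1, hI'⟩ := exists_idempotent_integral k A
    have : e' ∈ leftIntegrals k A := hI' ▸ Submodule.mem_span_singleton_self e'
    rw [hI] at this
    have h0 : e' = 0 := by simpa using this
    simp [h0] at h1
  have h := mul_generator hI e
  rw [he.eq] at h
  exact smul_left_injective k hne (by simpa using h.symm)

lemma existsUnique_idempotent_integral [IsReduced A] :
    ∃! e : A, IsIdempotentElem e ∧ leftIntegrals k A = Submodule.span k {e} := by
  obtain ⟨e, he, h1, hI⟩ := exists_idempotent_integral k A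
  refine ⟨e, ⟨he, hI⟩, ?_⟩
  rintro e' ⟨he', hI'⟩
  have h := mul_generator hI e'
  have h' := mul_generator hI' e
  rw [counit_generator he' hI', one_smul] at h
  rw [h1, one_smul] at h'
  rw [← h, mul_comm, h']

omit [Module.Finite k A] in
lemma galoisMap_comul_surjective :
    Function.Surjective (galoisMap (Bialgebra.comulAlgHom k A)) := by
  intro z
  induction z with
  | zero => exact ⟨0, map_zero _⟩
  | add z w hz hw =>
    obtain ⟨u, rfl⟩ := hz
    obtain ⟨v, rfl⟩ := hw
    exact ⟨u + v, map_add _ _ _⟩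
  | tmul a b =>
    -- The inverse of the Galois map of `Δ` is `a ⊗ b ↦ ∑ a S(b₍₁₎) ⊗ b₍₂₎`.
    refine ⟨∑ i ∈ (ℛ k b).index,
      (a * antipode k ((ℛ k b).left i)) ⊗ₜ[k] (ℛ k b).right i, ?_⟩
    have := congrArg ((a ⊗ₜ[k] (1 : A)) * ·) (sum_antipode_tmul_one_mul_comul (R := k) b)
    simpa [Finset.mul_sum, ← mul_assoc] using this

variable (k A) in
lemma galoisMap_comul_bijective :
    Function.Bijective (galoisMap (Bialgebra.comulAlgHom k A)) := by
  have h := galoisMap_comul_surjective (k := k) (A := A)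
  have h' := (LinearMap.injective_iff_surjective
    (f := (galoisMap (Bialgebra.comulAlgHom k A)).toLinearMap.restrictScalars k)).2 h
  exact ⟨h', h⟩

lemma slice_trace_comul (x : A) :
    slice (Algebra.trace k A) (comul x) = algebraMap k A (Algebra.trace k A x) :=
  slice_trace_coaction (galoisMap_comul_bijective k A) x

/-- Multiplication by `e` is the rank-one map `a ↦ ε(a) e`, whose trace is `ε(e)`. -/
lemma trace_generator [IsReduced A] {e : A} (he : IsIdempotentElem e)
    (hI : leftIntegrals k A = Submodule.span k {e}) : Algebra.trace k A e = 1 := by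
  have : Algebra.lmul k A e = (counit (R := k) (A := A)).smulRight e := by
    ext a
    simp [mul_comm e, mul_generator hI a]
  rw [Algebra.trace_apply, this, LinearMap.trace_smulRight, counit_generator he hI]

/-- The functional `Tr` solves `t e = 1`. -/
lemma slice_trace_comul_generator [IsReduced A] {e : A} (he : IsIdempotentElem e)
    (hI : leftIntegrals k A = Submodule.span k {e}) :
    slice (Algebra.trace k A) (comul e) = 1 := by
  rw [slice_trace_comul, trace_generator he hI, map_one]

/-- `f ↦ f e` is injective on functionals. -/
lemma slice_comul_generator_injective [IsReduced A] {e : A} (he : IsIdempotentElem e)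
    (hI : leftIntegrals k A = Submodule.span k {e}) :
    Function.Injective fun f : A →ₗ[k] k => slice f (comul (R := k) e) := by
  let F : (A →ₗ[k] k) →ₗ[k] A :=
    { toFun := fun f => slice f (comul (R := k) e)
      map_add' := fun f g => by simp [slice, LinearMap.lTensor_add]
      map_smul' := fun c f => slice_smul c f _ }
  have hs : Function.Surjective F := by
    intro c
    -- Contracting `(1 ⊗ S(c)) Δ(e) = (c ⊗ 1) Δ(e)` with `Tr` gives `c (Tr · e) = c`.
    refine ⟨Algebra.trace k A ∘ₗ LinearMap.mulLeft k (antipode k c), ?_⟩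
    have he' : e ∈ leftIntegrals k A := hI ▸ Submodule.mem_span_singleton_self e
    change slice _ (comul (R := k) e) = c
    rw [← slice_one_tmul_mul, ← comul_integral_mul he', slice_tmul_one_mul,
      slice_trace_comul_generator he hI, mul_one]
  exact (LinearMap.injective_iff_surjective_of_finrank_eq_finrank
    (Subspace.dual_finrank_eq (K := k) (V := A))).2 hs

lemma eq_trace_of_dualAct_generator [IsReduced A] {e : A} (he : IsIdempotentElem e)
    (hI : leftIntegrals k A = Submodule.span k {e}) {t : DualAlg k A} :
    dualAct comul t e = 1 ↔ t.ofConv = Algebra.trace k A := by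
  rw [dualAct_apply, ← slice_trace_comul_generator he hI]
  exact (slice_comul_generator_injective he hI).eq_iff

/-- The element of `B ⊗ B` corresponding to a multiple of `1 ⊗ e` reproduces `B` under the trace
form. -/
lemma slice_trace_mul_of_galoisMap_eq {B : Type*} [CommRing B] [Algebra k B] [Module.Finite k B]
    [IsReduced A] {e : A} (he : IsIdempotentElem e)
    (hI : leftIntegrals k A = Submodule.span k {e}) {α : B →ₐ[k] B ⊗[k] A}
    (h : Function.Bijective (galoisMap α)) (hc : ∀ b, slice counit (α b) = b)
    {q : B ⊗[k] B} {c : k} (hq : galoisMap α q = 1 ⊗ₜ (c • e)) (z : B) :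
    slice (Algebra.trace k B) (q * (1 ⊗ₜ z)) = c • z := by
  -- Multiplication by `1 ⊗ e` applies the counit to the second factor; on `α(z)`, counitality
  -- returns `z`.
  have key : ∀ w : B ⊗[k] A, (1 ⊗ₜ (c • e)) * w = (slice counit w) ⊗ₜ[k] (c • e) := by
    intro w
    induction w with
    | zero => simp
    | add u v hu hv => rw [mul_add, hu, hv, map_add, TensorProduct.add_tmul]
    | tmul b a =>
      rw [Algebra.TensorProduct.tmul_mul_tmul, one_mul, slice_tmul, smul_mul_assoc, mul_comm e,
        mul_generator hI, smul_comm, TensorProduct.tmul_smul, TensorProduct.smul_tmul']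
  rw [← slice_trace_galoisMap h, map_mul, hq, Algebra.TensorProduct.lift_tmul, map_one, one_mul,
    key, hc, slice_tmul, map_smul, trace_generator he hI, smul_eq_mul, mul_one]

end Field

/-! ### Extension of scalars to the fraction field -/

section BaseChange

open Coalgebra HopfAlgebra

variable {R : Type*} [CommRing R] (K : Type*) [Field K] [Algebra R K]

/-- The canonical ring homomorphism `B ⊗ C → B_K ⊗ C_K`. -/
def tensorToGeneric (B C : Type*) [CommRing B] [Algebra R B] [CommRing C] [Algebra R C] :
    B ⊗[R] C →ₐ[R] (K ⊗[R] B) ⊗[K] (K ⊗[R] C) :=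
  Algebra.TensorProduct.lift
    (((Algebra.TensorProduct.includeLeft :
      K ⊗[R] B →ₐ[K] (K ⊗[R] B) ⊗[K] (K ⊗[R] C)).restrictScalars R).comp
        Algebra.TensorProduct.includeRight)
    (((Algebra.TensorProduct.includeRight :
      K ⊗[R] C →ₐ[K] (K ⊗[R] B) ⊗[K] (K ⊗[R] C)).restrictScalars R).comp
        Algebra.TensorProduct.includeRight)
    (fun _ _ => Commute.all _ _)

variable {B C : Type*} [CommRing B] [Algebra R B] [CommRing C] [Algebra R C]

@[simp]
lemma tensorToGeneric_tmul (b : B) (c : C) :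
    tensorToGeneric K B C (b ⊗ₜ[R] c) = ((1 : K) ⊗ₜ[R] b) ⊗ₜ[K] ((1 : K) ⊗ₜ[R] c) := by
  simp [tensorToGeneric]

lemma distribBaseChange_one_tmul (z : B ⊗[R] C) :
    TensorProduct.AlgebraTensorModule.distribBaseChange R K B C ((1 : K) ⊗ₜ[R] z) =
      tensorToGeneric K B C z := by
  induction z with
  | zero => simp
  | add z w hz hw => rw [TensorProduct.tmul_add, map_add, hz, hw, map_add]
  | tmul b c => simp

/-- The coaction `B_K → B_K ⊗ A_K` as an algebra homomorphism. -/
def genericCoactionHom (α : B →ₐ[R] B ⊗[R] C) :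
    K ⊗[R] B →ₐ[K] (K ⊗[R] B) ⊗[K] (K ⊗[R] C) :=
  Algebra.TensorProduct.lift (Algebra.ofId K _) ((tensorToGeneric K B C).comp α)
    (fun _ _ => Commute.all _ _)

@[simp]
lemma genericCoactionHom_one_tmul (α : B →ₐ[R] B ⊗[R] C) (b : B) :
    genericCoactionHom K α ((1 : K) ⊗ₜ[R] b) = tensorToGeneric K B C (α b) := by
  simp only [genericCoactionHom, Algebra.TensorProduct.lift_tmul, map_one, one_mul,
    AlgHom.coe_comp, Function.comp_apply]

lemma genericCoactionHom_toLinearMap (α : B →ₐ[R] B ⊗[R] C) :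
    (genericCoactionHom K α).toLinearMap = genericCoaction K α := by
  ext b
  simp [genericCoaction, distribBaseChange_one_tmul]

lemma genericCoaction_apply (α : B →ₐ[R] B ⊗[R] C) (x : K ⊗[R] B) :
    genericCoaction K α x = genericCoactionHom K α x := by
  rw [← genericCoactionHom_toLinearMap]; rfl

lemma galoisMap_tensorToGeneric (α : B →ₐ[R] B ⊗[R] C) (z : B ⊗[R] B) :
    galoisMap (genericCoactionHom K α) (tensorToGeneric K B B z) =
      tensorToGeneric K B C (galoisMap α z) := by
  induction z with
  | zero => simp
  | add z w hz hw => simp only [map_add, hz, hw]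
  | tmul b c =>
    rw [tensorToGeneric_tmul, Algebra.TensorProduct.lift_tmul, Algebra.TensorProduct.lift_tmul,
      genericCoactionHom_one_tmul, map_mul]
    congr 1
    simp [Algebra.TensorProduct.one_def]

/-- Up to the isomorphisms `K ⊗ (M ⊗ N) ≃ M_K ⊗ N_K`, this Galois map is the base change of the one
over `R`. -/
lemma galoisMap_genericCoactionHom_bijective {α : B →ₐ[R] B ⊗[R] C}
    (h : Function.Bijective (galoisMap α)) :
    Function.Bijective (galoisMap (genericCoactionHom K α)) := by
  let g : B ⊗[R] B ≃ₗ[R] B ⊗[R] C :=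
    LinearEquiv.ofBijective ((galoisMap α).toLinearMap.restrictScalars R) h
  let G := (TensorProduct.AlgebraTensorModule.distribBaseChange R K B B).symm ≪≫ₗ
    g.baseChange R K ≪≫ₗ TensorProduct.AlgebraTensorModule.distribBaseChange R K B C
  have hG : (galoisMap (genericCoactionHom K α)).toLinearMap.restrictScalars K =
      G.toLinearMap := by
    rw [← LinearEquiv.comp_coe, ← LinearEquiv.comp_coe]
    rw [← LinearMap.cancel_right
      (TensorProduct.AlgebraTensorModule.distribBaseChange R K B B).surjective]
    ext b b'
    have := galoisMap_tensorToGeneric K α (b ⊗ₜ b')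
    have hg : g (b ⊗ₜ b') = galoisMap α (b ⊗ₜ b') := rfl
    rw [← hg] at this
    simpa [distribBaseChange_one_tmul] using this
  have : ⇑(galoisMap (genericCoactionHom K α)) = ⇑G := congrArg DFunLike.coe hG
  rw [this]
  exact G.bijective

lemma slice_counit_genericCoactionHom {A : Type*} [CommRing A] [HopfAlgebra R A]
    {α : B →ₐ[R] B ⊗[R] A} (h : ∀ b, slice counit (α b) = b) (x : K ⊗[R] B) :
    slice (counit (R := K)) (genericCoactionHom K α x) = x := by
  have hz : ∀ z : B ⊗[R] A, slice (counit (R := K)) (tensorToGeneric K B A z) =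
      1 ⊗ₜ slice counit z := by
    intro z
    induction z with
    | zero => simp
    | add z w hz hw => rw [map_add, map_add, hz, hw, map_add, TensorProduct.tmul_add]
    | tmul b c => simp 
  have : slice (counit (R := K)) ∘ₗ (genericCoactionHom K α).toLinearMap = LinearMap.id := by
    ext b
    simp [hz, h]
  exact LinearMap.congr_fun this x

lemma comul_one_tmul {A : Type*} [CommRing A] [HopfAlgebra R A] (a : A) :
    comul (R := K) ((1 : K) ⊗ₜ[R] a) = tensorToGeneric K A A (comul (R := R) a) := by
  rw [TensorProduct.comul_tmul]
  generalize comul (R := R) a = z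
  induction z with
  | zero => simp
  | add z w hz hw => rw [TensorProduct.tmul_add, map_add, hz, hw, map_add]
  | tmul b c => simp

lemma slice_dualToGeneric {A : Type*} [CommRing A] [HopfAlgebra R A] (f : DualAlg R A)
    (z : B ⊗[R] A) : slice (dualToGeneric K A f).ofConv (tensorToGeneric K B A z) =
      1 ⊗ₜ slice f.ofConv z := by
  induction z with
  | zero => simp
  | add z w hz hw => rw [map_add, map_add, hz, hw, map_add, TensorProduct.tmul_add]
  | tmul b c => simp [dualToGeneric]

variable [IsFractionRing R K]

lemma toGeneric_injective (M : Type*) [AddCommGroup M] [Module R M] [Module.Flat R M] :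
    Function.Injective (toGeneric (R := R) K M) := by
  have h := Module.Flat.rTensor_preserves_injective_linearMap (M := M)
    (Algebra.linearMap R K) (IsFractionRing.injective R K)
  have : ⇑(toGeneric (R := R) K M) =
      LinearMap.rTensor M (Algebra.linearMap R K) ∘ (TensorProduct.lid R M).symm := by
    ext m; simp [toGeneric]
  rw [this]
  exact h.comp (LinearEquiv.injective _)

lemma tensorToGeneric_injective [Module.Flat R B] [Module.Flat R C] :
    Function.Injective (tensorToGeneric (R := R) K B C) := by
  intro x y h
  rw [← distribBaseChange_one_tmul, ← distribBaseChange_one_tmul] at h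
  exact toGeneric_injective K _ (LinearEquiv.injective _ h)

end BaseChange

/-! ### Dual integrals and integrality of the trace -/

section Integral

open Coalgebra HopfAlgebra

variable {R : Type*} [CommRing R] {A : Type*} [CommRing A] [HopfAlgebra R A]

/-- Convolution satisfies `(u f)(a) = u(f · a)`, and functionals separate the points of a projective
module. -/
lemma mem_dualLeftIntegrals_iff [Module.Projective R A] (f : DualAlg R A) :
    f ∈ dualLeftIntegrals R A ↔
      ∀ a, slice f.ofConv (comul (R := R) a) = algebraMap R A (f.ofConv a) := by
  have h1 : ∀ (u : DualAlg R A) (z : A ⊗[R] A), u.ofConv (slice f.ofConv z) =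
      LinearMap.mul' R R (TensorProduct.map u.ofConv f.ofConv z) := by
    intro u z
    induction z with
    | zero => simp
    | add z w hz hw => simp only [map_add, hz, hw]
    | tmul b c => simp [mul_comm]
  have h2 : ∀ (u : DualAlg R A) (a : A), (u * f).ofConv a = u.ofConv (slice f.ofConv (comul a)) :=
    fun u a => (h1 u _).symm
  constructor
  · intro h a
    rw [← sub_eq_zero, ← Module.forall_dual_apply_eq_zero_iff R]
    intro φ
    have := congrArg (fun g : DualAlg R A => g.ofConv a) (h (WithConv.toConv φ))
    simp only [h2] at this
    rw [map_sub, sub_eq_zero, Algebra.algebraMap_eq_smul_one, map_smul]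
    refine this.trans ?_
    simp [mul_comm]
  · intro h u
    ext a
    refine (h2 u a).trans ?_
    rw [h a, Algebra.algebraMap_eq_smul_one, map_smul]
    simp [mul_comm]

variable (R A) in
/-- The image of `I(A)` under the counit. -/
def counitIdeal : Ideal R := (leftIntegrals R A).map (counit (R := R) (A := A))

variable (K : Type*) [Field K] [Algebra R K]

/-- The witness is the partial trace of `b ↦ Δ(b a)`. Its counit is `∑ φ i (b i * a)`, the trace of
multiplication by `a` computed in a dual basis. -/
lemma trace_one_tmul_mem [Module.Finite R A] [Module.Projective R A] (a : A) :
    ∃ x ∈ leftIntegrals R A,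
      Algebra.trace K (K ⊗[R] A) (1 ⊗ₜ a) = algebraMap R K (counit (R := R) x) := by
  obtain ⟨n, f, g, -, -, hfg⟩ := Module.Finite.exists_comp_eq_id_of_projective R A
  let b : Fin n → A := fun i => f (Pi.single i 1)
  let φ : Fin n → A →ₗ[R] R := fun i => LinearMap.proj i ∘ₗ g
  have hb : ∀ a, ∑ i, φ i a • b i = a := by
    intro a
    conv_rhs => rw [← LinearMap.id_apply (R := R) a, ← hfg, LinearMap.comp_apply,
      pi_eq_sum_univ' (g a)]
    simp [φ, b]
  refine ⟨_, sum_slice_comul_mem b φ hb a, ?_⟩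
  have hc : ∀ (ψ : A →ₗ[R] R) (z : A ⊗[R] A),
      counit (R := R) (slice ψ z) = ψ (TensorProduct.lid R A (LinearMap.rTensor A counit z)) := by
    intro ψ z
    induction z with
    | zero => simp
    | add z w hz hw => simp only [map_add, hz, hw]
    | tmul b c => simp [mul_comm]
  have ht : Algebra.lmul K (K ⊗[R] A) (1 ⊗ₜ a) = ∑ i, (LinearMap.liftBaseChange K
      (Algebra.linearMap R K ∘ₗ φ i)).smulRight ((1 : K) ⊗ₜ[R] (b i * a)) := by
    ext c
    have : (1 : K) ⊗ₜ[R] (a * c) = ∑ i, (1 : K) ⊗ₜ[R] (φ i c • (b i * a)) := by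
      rw [← TensorProduct.tmul_sum]
      simp_rw [← smul_mul_assoc, ← Finset.sum_mul, hb, mul_comm]
    simpa [LinearMap.sum_apply, TensorProduct.smul_tmul', Algebra.algebraMap_eq_smul_one]
      using this
  simp_rw [map_sum, hc, rTensor_counit_comul]
  rw [Algebra.trace_apply, ht, map_sum]
  simp_rw [LinearMap.trace_smulRight]
  simp

end Integral

/-! ### Generators of the integrals and the codifferent -/

section Main

open Coalgebra HopfAlgebra

variable {R : Type*} [CommRing R] [IsDomain R] {K : Type*} [Field K] [Algebra R K]
  [IsFractionRing R K] {A : Type*} [CommRing A] [HopfAlgebra R A]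

omit [IsDomain R] [IsFractionRing R K] in
lemma counit_toGeneric (a : A) :
    counit (R := K) (toGeneric (R := R) K A a) = algebraMap R K (counit (R := R) a) := by
  simp [toGeneric, Algebra.algebraMap_eq_smul_one]

omit [IsDomain R] [IsFractionRing R K] in
lemma comul_toGeneric (a : A) :
    comul (R := K) (toGeneric (R := R) K A a) = tensorToGeneric K A A (comul (R := R) a) :=
  comul_one_tmul K a

omit [IsDomain R] [IsFractionRing R K] in
lemma toGeneric_mem_leftIntegrals {x : A} (hx : x ∈ leftIntegrals R A) :
    toGeneric (R := R) K A x ∈ leftIntegrals K (K ⊗[R] A) := by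
  intro a
  induction a with
  | zero => simp
  | add z w hz hw => rw [add_mul, hz, hw, map_add, add_smul]
  | tmul c a =>
    have : a * x = counit (R := R) a • x := hx a
    simp [toGeneric, this, TensorProduct.smul_tmul']

omit [IsDomain R] [IsFractionRing R K] in
lemma toGeneric_eq_counit_smul {e : K ⊗[R] A} (h1 : counit (R := K) e = 1)
    (hI : leftIntegrals K (K ⊗[R] A) = Submodule.span K {e}) {x : A}
    (hx : x ∈ leftIntegrals R A) :
    toGeneric (R := R) K A x = algebraMap R K (counit (R := R) x) • e := by
  have := toGeneric_mem_leftIntegrals (K := K) hx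
  rw [hI, Submodule.mem_span_singleton] at this
  obtain ⟨c, hc⟩ := this
  have h := congrArg (counit (R := K)) hc
  rw [map_smul, h1, counit_toGeneric, smul_eq_mul, mul_one] at h
  rw [← hc, h]

/-- Clearing the denominator of `e` gives `s e` in the image of `A`; by flatness its integral
property descends, and its counit is `s`. -/
lemma exists_integral_counit_ne_zero [Module.Flat R A] {e : K ⊗[R] A}
    (h1 : counit (R := K) e = 1) (hI : leftIntegrals K (K ⊗[R] A) = Submodule.span K {e}) :
    ∃ x ∈ leftIntegrals R A, counit (R := R) x ≠ 0 := by
  obtain ⟨⟨a, s⟩, hs⟩ := IsLocalizedModule.surj R⁰ (TensorProduct.mk R K A 1) e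
  have ha : toGeneric (R := R) K A a = algebraMap R K s • e := by
    rw [algebraMap_smul]
    exact hs.symm
  refine ⟨a, fun c => toGeneric_injective (R := R) K A ?_, ?_⟩
  · have : toGeneric (R := R) K A (c * a) = toGeneric (R := R) K A c * toGeneric (R := R) K A a := by simp [toGeneric]
    rw [this, ha, mul_smul_comm, mul_generator hI, map_smul, ha, counit_toGeneric, smul_comm,
      algebraMap_smul K (counit (R := R) c)]
  · intro h0
    have := congrArg (counit (R := K)) ha
    rw [counit_toGeneric, h0, map_smul, h1, map_zero, smul_eq_mul, mul_one, eq_comm] at this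
    exact nonZeroDivisors.coe_ne_zero s ((map_eq_zero_iff _ (IsFractionRing.injective R K)).1 this)

/-- A free module of integrals is generated by one element. -/
lemma exists_generator_leftIntegrals [Module.Flat R A] {e : K ⊗[R] A}
    (h1 : counit (R := K) e = 1) (hI : leftIntegrals K (K ⊗[R] A) = Submodule.span K {e})
    (hfree : Module.Free R (leftIntegrals R A)) :
    ∃ x, leftIntegrals R A = Submodule.span R {x} ∧ counit (R := R) x ≠ 0 := by
  obtain ⟨y, hy, hy0⟩ := exists_integral_counit_ne_zero h1 hI
  have hne : ∀ x : leftIntegrals R A, x ≠ 0 → counit (R := R) (x : A) ≠ 0 := by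
    intro x hx h0
    refine hx (Subtype.ext (toGeneric_injective (R := R) K A ?_))
    rw [toGeneric_eq_counit_smul h1 hI x.2, h0]
    simp
  let b := Module.Free.chooseBasis R (leftIntegrals R A)
  have hs : ∀ i j : Module.Free.ChooseBasisIndex R (leftIntegrals R A), i = j := by
    intro i j
    by_contra hij
    -- For integrals `x`, `y`, commutativity gives `ε(x) y = x y = ε(y) x`, a linear relation that
    -- distinct basis elements cannot satisfy.
    have : counit (R := R) (b j : A) • b i = counit (R := R) (b i : A) • b j := by
      apply Subtype.ext
      have h2 := (b i).2 (b j)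
      have h3 := (b j).2 (b i)
      rw [mul_comm, h3] at h2
      exact h2.symm
    have h4 := congrArg (fun v => b.repr v i) this
    simp [Ne.symm hij] at h4
    exact hne _ (b.ne_zero j) h4
  have hn : Nonempty (Module.Free.ChooseBasisIndex R (leftIntegrals R A)) := by
    by_contra hemp
    rw [not_nonempty_iff] at hemp
    have : (⟨y, hy⟩ : leftIntegrals R A) = 0 := b.ext_elem fun i => hemp.elim i
    rw [Subtype.ext_iff] at this
    simp [show y = 0 from this] at hy0
  obtain ⟨i⟩ := hn
  refine ⟨b i, le_antisymm (fun x hx => ?_) ?_, hne _ (b.ne_zero i)⟩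
  · rw [Submodule.mem_span_singleton]
    let _ : Unique (Module.Free.ChooseBasisIndex R (leftIntegrals R A)) :=
      ⟨⟨i⟩, fun j => hs j i⟩
    refine ⟨b.repr ⟨x, hx⟩ i, ?_⟩
    have := congrArg Subtype.val (b.sum_repr ⟨x, hx⟩)
    rw [Fintype.sum_unique] at this
    exact this
  · rw [Submodule.span_singleton_le_iff_mem]
    exact (b i).2

omit [IsDomain R] [IsFractionRing R K] in
lemma fracSMul_injective {V : Type*} [AddCommGroup V] [Module R V] [Module K V]
    [IsScalarTower R K V] {v : V} (hv : v ≠ 0) :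
    Function.Injective fun J : FractionalIdeal R⁰ K => fracSMul J v := by
  intro J J' h
  exact FractionalIdeal.coeToSubmodule_injective
    (Submodule.map_injective_of_injective (smul_left_injective K hv) h)

omit [IsDomain R] [IsFractionRing R K] in
lemma map_leftIntegrals_eq_fracSMul {e : K ⊗[R] A} (h1 : counit (R := K) e = 1)
    (hI : leftIntegrals K (K ⊗[R] A) = Submodule.span K {e}) :
    (leftIntegrals R A).map (toGeneric (R := R) K A) =
      fracSMul (counitIdeal R A : FractionalIdeal R⁰ K) e := by
  ext z
  simp only [Submodule.mem_map, fracSMul, FractionalIdeal.coe_coeIdeal,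
    IsLocalization.coeSubmodule, counitIdeal]
  constructor
  · rintro ⟨x, hx, rfl⟩
    exact ⟨_, ⟨_, ⟨x, hx, rfl⟩, rfl⟩, (toGeneric_eq_counit_smul h1 hI hx).symm⟩
  · rintro ⟨_, ⟨_, ⟨x, hx, rfl⟩, rfl⟩, rfl⟩
    exact ⟨x, hx, toGeneric_eq_counit_smul h1 hI hx⟩

omit [IsDomain R] in
/-- The trace of `A_K`, divided by the counit of a generator of `I(A)`, is integral on `A`. -/
lemma exists_dualAlg_eq_inv_smul_trace [Module.Finite R A] [Module.Projective R A] {x : A}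
    (hx : leftIntegrals R A = Submodule.span R {x}) (hx0 : counit (R := R) x ≠ 0) :
    ∃ y : DualAlg R A, (dualToGeneric K A y).ofConv =
      (algebraMap R K (counit (R := R) x))⁻¹ • Algebra.trace K (K ⊗[R] A) := by
  have hl : algebraMap R K (counit (R := R) x) ≠ 0 :=
    (map_ne_zero_iff _ (IsFractionRing.injective R K)).2 hx0
  have h : ∀ a : A, ∃ r : R, algebraMap R K r =
      (algebraMap R K (counit (R := R) x))⁻¹ * Algebra.trace K (K ⊗[R] A) (1 ⊗ₜ a) := by
    intro a
    obtain ⟨u, hu, htr⟩ := trace_one_tmul_mem (R := R) K a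
    rw [hx, Submodule.mem_span_singleton] at hu
    obtain ⟨r, rfl⟩ := hu
    refine ⟨r, ?_⟩
    rw [htr, map_smul, smul_eq_mul, map_mul]
    field_simp
  choose f hf using h
  refine ⟨WithConv.toConv ⟨⟨f, fun a b => ?_⟩, fun r a => ?_⟩, ?_⟩
  · apply IsFractionRing.injective R K
    rw [map_add, hf, hf, hf, TensorProduct.tmul_add, map_add, mul_add]
  · apply IsFractionRing.injective R K
    rw [hf, TensorProduct.tmul_smul, ← algebraMap_smul K r, map_smul, RingHom.id_apply,
      smul_eq_mul, smul_eq_mul, map_mul, hf]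
    ring
  · ext a
    simpa [dualToGeneric] using hf a

omit [IsDomain R] in
lemma mem_fracSMul_spanSingleton_iff {V : Type*} [AddCommGroup V] [Module R V] [Module K V]
    [IsScalarTower R K V] {c : K} {v w : V} :
    w ∈ fracSMul (FractionalIdeal.spanSingleton R⁰ c) v ↔ ∃ r : R, r • c • v = w := by
  simp only [fracSMul, FractionalIdeal.coe_spanSingleton, Submodule.mem_map,
    Submodule.mem_span_singleton]
  constructor
  · rintro ⟨_, ⟨r, rfl⟩, rfl⟩
    exact ⟨r, by simp⟩
  · rintro ⟨r, rfl⟩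
    exact ⟨_, ⟨r, rfl⟩, by simp⟩

variable [Module.Finite R A] [Module.Projective R A] [IsReduced (K ⊗[R] A)] {e : K ⊗[R] A}
  {t : DualAlg K (K ⊗[R] A)} {x : A}

omit [IsDomain R] in
lemma map_dualLeftIntegrals (he : IsIdempotentElem e)
    (hI : leftIntegrals K (K ⊗[R] A) = Submodule.span K {e})
    (ht : t.ofConv = Algebra.trace K (K ⊗[R] A))
    (hx : leftIntegrals R A = Submodule.span R {x}) (hx0 : counit (R := R) x ≠ 0) :
    (dualLeftIntegrals R A).map (dualToGeneric K A) =
      fracSMul (FractionalIdeal.spanSingleton R⁰ (algebraMap R K (counit (R := R) x))⁻¹) t := by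
  set l := algebraMap R K (counit (R := R) x) with hl
  have hl0 : l ≠ 0 := (map_ne_zero_iff _ (IsFractionRing.injective R K)).2 hx0
  have := Module.Flat.of_projective (R := R) (M := A)
  ext g
  rw [mem_fracSMul_spanSingleton_iff, Submodule.mem_map]
  constructor
  · rintro ⟨f, hf, rfl⟩
    -- Since `x = l e` over `K`, `f · x = f(x) 1` gives `f · e = l⁻¹ f(x) 1`, which is `(f(x) l⁻¹ t)
    -- · e`; then `f ↦ f · e` is injective.
    refine ⟨f.ofConv x, ?_⟩
    rw [mem_dualLeftIntegrals_iff] at hf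
    apply WithConv.ofConv_injective
    apply slice_comul_generator_injective he hI
    have hxe : toGeneric (R := R) K A x = l • e := toGeneric_eq_counit_smul (counit_generator he hI) hI
      (hx ▸ Submodule.mem_span_singleton_self x)
    have h1 := slice_dualToGeneric K f (comul (R := R) x)
    rw [← comul_toGeneric, hxe, hf, map_smul, map_smul] at h1
    have h2 : slice (dualToGeneric K A f).ofConv (comul (R := K) e) =
        l⁻¹ • ((1 : K) ⊗ₜ[R] algebraMap R A (f.ofConv x)) := by
      rw [← h1, smul_smul, inv_mul_cancel₀ hl0, one_smul]
    have h3 : slice (f.ofConv x • l⁻¹ • t).ofConv (comul (R := K) e) =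
        f.ofConv x • l⁻¹ • slice t.ofConv (comul (R := K) e) := by
      rw [← algebraMap_smul K (f.ofConv x) (l⁻¹ • t),
        ← algebraMap_smul K (f.ofConv x) (l⁻¹ • slice t.ofConv (comul (R := K) e)),
        WithConv.ofConv_smul, WithConv.ofConv_smul, slice_smul, slice_smul]
    beta_reduce
    rw [h2, h3, ht, slice_trace_comul_generator he hI, Algebra.algebraMap_eq_smul_one,
      TensorProduct.tmul_smul, smul_comm, Algebra.TensorProduct.one_def]
  · rintro ⟨r, rfl⟩
    obtain ⟨y, hy⟩ := exists_dualAlg_eq_inv_smul_trace (K := K) hx hx0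
    have hyt : dualToGeneric K A y = l⁻¹ • t := by
      apply WithConv.ofConv_injective
      rw [hy, WithConv.ofConv_smul, ht]
    refine ⟨r • y, Submodule.smul_mem _ _ ?_, by rw [map_smul, hyt]⟩
    rw [mem_dualLeftIntegrals_iff]
    intro a
    apply toGeneric_injective (R := R) K A
    change (1 : K) ⊗ₜ[R] _ = (1 : K) ⊗ₜ[R] _
    rw [← slice_dualToGeneric, hy, ← hl, ← comul_toGeneric]
    have h5 : algebraMap R K (y.ofConv a) = l⁻¹ * Algebra.trace K (K ⊗[R] A) (1 ⊗ₜ a) := by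
      have := LinearMap.congr_fun hy (1 ⊗ₜ a)
      simpa [dualToGeneric] using this
    rw [slice_smul, slice_trace_comul, Algebra.algebraMap_eq_smul_one (A := A), TensorProduct.tmul_smul,
      ← algebraMap_smul K (y.ofConv a), h5, Algebra.algebraMap_eq_smul_one (A := K ⊗[R] A), smul_smul]
    rfl

variable {B : Type*} [CommRing B] [Algebra R B] {α : B →ₐ[R] B ⊗[R] A}

omit [IsDomain R] [IsFractionRing R K] [Module.Projective R A] [IsReduced (K ⊗[R] A)] in
lemma IsPHS.slice_trace_genericCoactionHom (hα : IsPHS α) (z : K ⊗[R] B) :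
    slice (Algebra.trace K (K ⊗[R] A)) (genericCoactionHom K α z) =
      algebraMap K (K ⊗[R] B) (Algebra.trace K (K ⊗[R] B) z) := by
  have := hα.finite
  exact slice_trace_coaction (galoisMap_genericCoactionHom_bijective K hα.bijective) z

omit [IsReduced (K ⊗[R] A)] in
-- With `y` the integral form of `l⁻¹ Tr`, the element `y · b` of `B` becomes the scalar `l⁻¹ Tr(b)`
-- in `B_K`. It is therefore coinvariant and comes from `R`.
lemma IsPHS.exists_trace_eq (hα : IsPHS α)
    (hx : leftIntegrals R A = Submodule.span R {x}) (hx0 : Coalgebra.counit (R := R) x ≠ 0) (b : B) :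
    ∃ r : R, Algebra.trace K (K ⊗[R] B) (1 ⊗ₜ b) =
      algebraMap R K (Coalgebra.counit (R := R) x) * algebraMap R K r := by
  set l := algebraMap R K (Coalgebra.counit (R := R) x) with hl
  have hl0 : l ≠ 0 := (map_ne_zero_iff _ (IsFractionRing.injective R K)).2 hx0
  have := hα.flat
  have := Module.Flat.of_projective (R := R) (M := A)
  obtain ⟨y, hy⟩ := exists_dualAlg_eq_inv_smul_trace (K := K) hx hx0
  have h1 := slice_dualToGeneric K y (α b)
  rw [hy, slice_smul, ← genericCoactionHom_one_tmul, hα.slice_trace_genericCoactionHom, Algebra.smul_def,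
    ← map_mul] at h1
  set w := slice y.ofConv (α b)
  have hw : α w = w ⊗ₜ 1 := by
    apply tensorToGeneric_injective K
    rw [← genericCoactionHom_one_tmul, ← h1, AlgHom.commutes, tensorToGeneric_tmul, ← h1,
      ← Algebra.TensorProduct.one_def, Algebra.TensorProduct.algebraMap_apply]
  obtain ⟨r, hr⟩ := (hα.coinvariants w).1 hw
  refine ⟨r, ?_⟩
  have : Nontrivial (K ⊗[R] B) :=
    ((toGeneric_injective (R := R) K B).comp hα.injective).nontrivial
  have h5 : algebraMap K (K ⊗[R] B) (l⁻¹ * Algebra.trace K (K ⊗[R] B) (1 ⊗ₜ b)) =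
      algebraMap K (K ⊗[R] B) (algebraMap R K r) := by
    rw [h1, ← hr, ← IsScalarTower.algebraMap_apply, Algebra.algebraMap_eq_smul_one (R := R),
      TensorProduct.tmul_smul, Algebra.algebraMap_eq_smul_one (R := R),
      Algebra.TensorProduct.one_def]
  rw [← (algebraMap K (K ⊗[R] B)).injective h5, mul_inv_cancel_left₀ hl0]

lemma IsPHS.codifferent_eq (hα : IsPHS α) (he : IsIdempotentElem e)
    (hI : leftIntegrals K (K ⊗[R] A) = Submodule.span K {e})
    (hx : leftIntegrals R A = Submodule.span R {x}) (hx0 : Coalgebra.counit (R := R) x ≠ 0) :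
    codifferent R K B =
      fracMul (FractionalIdeal.spanSingleton R⁰ (algebraMap R K (Coalgebra.counit (R := R) x))⁻¹) B := by
  set l := algebraMap R K (Coalgebra.counit (R := R) x) with hl
  have hl0 : l ≠ 0 := (map_ne_zero_iff _ (IsFractionRing.injective R K)).2 hx0
  have := hα.finite
  have := hα.flat
  have := Module.Flat.of_projective (R := R) (M := A)
  apply le_antisymm
  · intro z hz
    -- Over `K` this `q` maps to `1 ⊗ l e`, so contracting `q (1 ⊗ z)` with the trace yields `l z`.
    obtain ⟨q, hq⟩ := hα.bijective.2 (1 ⊗ₜ x)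
    have hxe : toGeneric (R := R) K A x = l • e := toGeneric_eq_counit_smul (counit_generator he hI) hI
      (hx ▸ Submodule.mem_span_singleton_self x)
    have hqK : galoisMap (genericCoactionHom K α) (tensorToGeneric K B B q) = 1 ⊗ₜ (l • e) := by
      rw [galoisMap_tensorToGeneric, ← hxe]
      exact (congrArg _ hq).trans (tensorToGeneric_tmul K _ _)
    have h := slice_trace_mul_of_galoisMap_eq he hI
      (galoisMap_genericCoactionHom_bijective K hα.bijective)
      (slice_counit_genericCoactionHom K hα.counit) hqK z
    -- As `z` is in the codifferent, `b ⊗ b'` contracts to `Tr(z b') b` with `Tr(z b') ∈ R`, an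
    -- element of `B`.
    have hmem : ∀ p : B ⊗[R] B, ∃ b : B, slice (Algebra.trace K (K ⊗[R] B))
        (tensorToGeneric K B B p * (1 ⊗ₜ z)) = toGeneric (R := R) K B b := by
      intro p
      induction p with
      | zero => exact ⟨0, by simp⟩
      | add p p' hp hp' =>
        obtain ⟨b, hb⟩ := hp
        obtain ⟨b', hb'⟩ := hp'
        exact ⟨b + b', by rw [map_add, add_mul, map_add, hb, hb', map_add]⟩
      | tmul b b' =>
        obtain ⟨r, hr⟩ := Submodule.mem_one.1 (hz (toGeneric (R := R) K B b') ⟨b', rfl⟩)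
        rw [Algebra.traceForm_apply] at hr
        refine ⟨r • b, ?_⟩
        rw [tensorToGeneric_tmul, Algebra.TensorProduct.tmul_mul_tmul, mul_one, slice_tmul,
          mul_comm _ z]
        change Algebra.trace K (K ⊗[R] B) (z * toGeneric (R := R) K B b') • toGeneric (R := R) K B b = _
        rw [← hr, algebraMap_smul, map_smul]
    obtain ⟨b, hb⟩ := hmem q
    refine Submodule.subset_span ⟨l⁻¹, FractionalIdeal.mem_spanSingleton_self _ _, b, ?_⟩
    rw [← hb, h, smul_smul, inv_mul_cancel₀ hl0, one_smul]
  · refine Submodule.span_le.2 ?_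
    rintro _ ⟨c, hc, b, rfl⟩ _ ⟨b', rfl⟩
    obtain ⟨r, rfl⟩ := (FractionalIdeal.mem_spanSingleton _).1 hc
    obtain ⟨r', hr'⟩ := hα.exists_trace_eq (K := K) hx hx0 (b * b')
    rw [Algebra.traceForm_apply, smul_mul_assoc, map_smul,
      show toGeneric (R := R) K B b * toGeneric (R := R) K B b' = (1 : K) ⊗ₜ[R] (b * b') by simp [toGeneric], hr',
      Submodule.mem_one]
    refine ⟨r * r', ?_⟩
    rw [map_mul, smul_eq_mul, Algebra.smul_def, ← hl]
    field_simp

end Main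

end HopfPHS

end

theorem corollary3p3
    {R : Type*} [CommRing R] [IsDomain R] [IsNoetherianRing R] (h2 : IsUnit (2 : R))
    {K : Type*} [Field K] [Algebra R K] [IsFractionRing R K]
    {A : Type*} [CommRing A] [HopfAlgebra R A] [Module.Finite R A] [Module.Flat R A]
    (hfree : Module.Free R (HopfPHS.leftIntegrals R A))
    (hsep : Algebra.IsSeparable K (K ⊗[R] A)) :
    (∃! e : K ⊗[R] A, IsIdempotentElem e ∧
      HopfPHS.leftIntegrals K (K ⊗[R] A) = Submodule.span K {e}) ∧
    ∀ e : K ⊗[R] A, IsIdempotentElem e →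
      HopfPHS.leftIntegrals K (K ⊗[R] A) = Submodule.span K {e} →
      (∃! Λ : FractionalIdeal R⁰ K,
        (HopfPHS.leftIntegrals R A).map (HopfPHS.toGeneric K A) = HopfPHS.fracSMul Λ e) ∧
      (∃! t : HopfPHS.DualAlg K (K ⊗[R] A),
        HopfPHS.dualAct Coalgebra.comul t e = 1) ∧
      ∀ (Λ : FractionalIdeal R⁰ K) (t : HopfPHS.DualAlg K (K ⊗[R] A)),
        (HopfPHS.leftIntegrals R A).map (HopfPHS.toGeneric K A) = HopfPHS.fracSMul Λ e →
        HopfPHS.dualAct Coalgebra.comul t e = 1 →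
        (HopfPHS.dualLeftIntegrals R A).map (HopfPHS.dualToGeneric K A) =
          HopfPHS.fracSMul Λ⁻¹ t ∧
        ∀ (B : Type*) [CommRing B] [Algebra R B] (α : B →ₐ[R] B ⊗[R] A), HopfPHS.IsPHS α →
          (∀ x : K ⊗[R] B,
            algebraMap K (K ⊗[R] B) (Algebra.trace K (K ⊗[R] B) x) =
              HopfPHS.dualAct (HopfPHS.genericCoaction K α) t x) ∧
          HopfPHS.codifferent R K B = HopfPHS.fracMul Λ⁻¹ B := by
  have : Module.FinitePresentation R A := Module.finitePresentation_of_finite R A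
  have : Module.Projective R A := Module.Flat.projective_of_finitePresentation
  have : IsReduced (K ⊗[R] A) := HopfPHS.isReduced_of_isSeparable hsep
  refine ⟨HopfPHS.existsUnique_idempotent_integral, fun e he hI => ?_⟩
  have h1 := HopfPHS.counit_generator he hI
  have hne : e ≠ 0 := by
    rintro rfl
    simp at h1
  have hΛ := HopfPHS.map_leftIntegrals_eq_fracSMul h1 hI
  refine ⟨⟨_, hΛ, fun Λ h => HopfPHS.fracSMul_injective hne (h.symm.trans hΛ)⟩,
    ⟨WithConv.toConv (Algebra.trace K (K ⊗[R] A)),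
      (HopfPHS.eq_trace_of_dualAct_generator he hI).2 rfl, fun t ht =>
        WithConv.ofConv_injective ((HopfPHS.eq_trace_of_dualAct_generator he hI).1 ht)⟩, ?_⟩
  intro Λ t h ht
  obtain ⟨x, hx, hx0⟩ := HopfPHS.exists_generator_leftIntegrals h1 hI hfree
  have ht' := (HopfPHS.eq_trace_of_dualAct_generator he hI).1 ht
  -- By uniqueness `Λ` is the image of `I(A)` under the counit, the principal ideal generated by
  -- `ε(x)`.
  have hΛ' : Λ⁻¹ = FractionalIdeal.spanSingleton R⁰
      (algebraMap R K (Coalgebra.counit (R := R) x))⁻¹ := by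
    rw [HopfPHS.fracSMul_injective hne (h.symm.trans hΛ), HopfPHS.counitIdeal, hx,
      Submodule.map_span, Set.image_singleton]
    exact (congrArg _ (FractionalIdeal.coeIdeal_span_singleton _)).trans
      (FractionalIdeal.spanSingleton_inv K _)
  rw [hΛ']
  refine ⟨HopfPHS.map_dualLeftIntegrals he hI ht' hx hx0, fun B _ _ α hα => ⟨fun z => ?_, ?_⟩⟩
  · rw [HopfPHS.dualAct_apply, ht', HopfPHS.genericCoaction_apply,
      hα.slice_trace_genericCoactionHom]
  · exact hα.codifferent_eq he hI hx hx0
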